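/- Let $n\ge 2$ be an integer, let $m=n-1$, and let $b,c\in\mathbb{C}$ satisfy $|b|=1$ and $0<|c|<1$. Let $\Omega_n\subset\mathbb{P}^2_{\mathbb{C}}$ be the set of all points $[1:\beta:\gamma]$ of the complex projective plane, $\beta,\gamma\in\mathbb{C}$, for which the trinomial $\zeta^n+\beta\zeta^m+\gamma$ is Schur stable, that is, all its complex roots have modulus strictly smaller than $1$. Then $[1:b:c]\in\Omega_n$ if and only if both of the following hold: (i) $\displaystyle \frac{n-1}{2n-1}\,\pi<\arccos\left(\frac{|c|}{2}\right)<\frac{\pi}{2}$; (ii) there exist $s\in[0,2\pi]$ and $t\in\mathbb{R}$ with $$|t|<\frac{(2n-1)\arccos\left(\frac{|c|}{2}\right)-(n-1)\pi}{n}$$ such that $$[1:b:c]=\left[1:e^{\mathsf{i}t}e^{-\mathsf{i}s}:(-1)^n|c|e^{-\mathsf{i}ns}\right].$$ -/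

import Mathlib

open scoped Polynomial

/-- A complex polynomial is Schur stable if all its roots have modulus strictly smaller than one.
(The zero polynomial is not Schur stable, since every number is a root of it.) -/
def IsSchurStable (p : ℂ[X]) : Prop :=
  ∀ z : ℂ, p.IsRoot z → ‖z‖ < 1

/-- The trinomial `a ζ ^ n + b ζ ^ m + c`. -/
noncomputable def complexTrinomial (n m : ℕ) (a b c : ℂ) : ℂ[X] :=
  Polynomial.C a * Polynomial.X ^ n + Polynomial.C b * Polynomial.X ^ m + Polynomial.C c

theorem one_vec_ne_zero (b c : ℂ) : (![1, b, c] : Fin 3 → ℂ) ≠ 0 := by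
  intro h
  have h0 := congrFun h 0
  simp at h0

/-- The point `[1 : b : c]` of the complex projective plane. -/
noncomputable def projPoint (b c : ℂ) : Projectivization ℂ (Fin 3 → ℂ) :=
  Projectivization.mk ℂ ![1, b, c] (one_vec_ne_zero b c)

/-- The stability region: the set of the points `[1 : b : c]` of the complex projective plane
for which the trinomial `ζ ^ n + b ζ ^ m + c` is Schur stable. -/
def stabilityRegion (n m : ℕ) : Set (Projectivization ℂ (Fin 3 → ℂ)) :=
  {p | ∃ b c : ℂ, p = projPoint b c ∧ IsSchurStable (complexTrinomial n m 1 b c)}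

/-! Write `n = m + 1`, `r = ‖c‖`. Suitable `s`, `t` with `n * |t| ≤ π` give `b`, `c` the form in
(ii), and `ζ = -b v` turns the root equation into `v ^ m * (1 - v) = r * exp (-i u)`, `u = n t`. The
claim becomes: for `|u| ≤ π`, a solution with `1 ≤ ‖v‖` exists iff `|u|` is at least `B = (2m+1)
arccos (r/2) - mπ`.

By conjugation take `0 ≤ v.im`. In the triangle `0, 1, v`, let `ψ = arg v` and `χ = arg (v - 1)`.
Being outside the disc forces `χ ≤ π/2 + ψ/2` and `2 sin (ψ/2) ≤ ‖v - 1‖ ≤ r`, so `B ≤ π - χ - mψ ≤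
π`, an angle congruent to `u` mod `2π` (`not_abs_lt_of_im_nonneg`). Conversely, the law of sines and
the intermediate value theorem build such a triangle (`exists_angle`). Condition (i) says `0 < B`
and `r > 0`. -/

/-! ### Necessary condition for a solution outside the open disc -/

open Complex in
/-- If `v` lies outside the open unit disc and in the closed upper half plane, then the argument
of `v ^ m * (1 - v)` is bounded away from zero in terms of its modulus. -/
theorem not_abs_lt_of_im_nonneg {m : ℕ} {r u : ℝ} {v : ℂ} (hr : 0 < r) (hv : 1 ≤ ‖v‖)
    (him : 0 ≤ v.im) (h : v ^ m * (1 - v) = r * exp (-(I * u))) :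
    ¬ |u| < (2 * m + 1) * Real.arccos (r / 2) - m * Real.pi := by
  intro hu
  have hpi := Real.pi_pos
  set ψ := arg v with hψ
  set χ := arg (v - 1) with hχ
  set ρ := ‖v‖ with hρ
  set σ := ‖v - 1‖ with hσ
  have hψ0 : 0 ≤ ψ := arg_nonneg_iff.2 him
  have hχ0 : 0 ≤ χ := arg_nonneg_iff.2 (by simpa using him)
  have hψπ : ψ ≤ Real.pi := arg_le_pi v
  have hχπ : χ ≤ Real.pi := arg_le_pi _
  have hvp : (ρ : ℂ) * exp (ψ * I) = v := norm_mul_exp_arg_mul_I v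
  have hvp' : (σ : ℂ) * exp (χ * I) = v - 1 := norm_mul_exp_arg_mul_I (v - 1)
  have hnorm : ρ ^ m * σ = r := by
    have := congrArg norm h
    rw [norm_mul, norm_pow, norm_sub_rev, norm_mul, norm_real, Real.norm_of_nonneg hr.le,
      show -(I * (u : ℂ)) = ((-u : ℝ) : ℂ) * I by push_cast; ring, norm_exp_ofReal_mul_I,
      mul_one] at this
    exact this
  have hσ0 : 0 < σ := by
    rcases (norm_nonneg (v - 1)).eq_or_lt with h0 | h0
    · rw [← hσ] at h0; rw [← h0, mul_zero] at hnorm; exact absurd hnorm hr.ne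
    · exact h0
  have hσr : σ ≤ r := by
    rw [← hnorm]; exact le_mul_of_one_le_left hσ0.le (one_le_pow₀ hv)
  have hre : σ * Real.cos χ = ρ * Real.cos ψ - 1 := by
    have := congrArg re hvp'
    rw [← hvp] at this
    simpa [exp_ofReal_mul_I_re] using this
  have him' : σ * Real.sin χ = ρ * Real.sin ψ := by
    have := congrArg im hvp'
    rw [← hvp] at this
    simpa [exp_ofReal_mul_I_im] using this
  have hc2 : 0 ≤ Real.cos (ψ / 2) := Real.cos_nonneg_of_mem_Icc ⟨by linarith, by linarith⟩
  have hcos : Real.cos ψ = 2 * Real.cos (ψ / 2) ^ 2 - 1 := by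
    rw [← Real.cos_two_mul]; congr 1; ring
  have hsin : Real.sin ψ = 2 * Real.sin (ψ / 2) * Real.cos (ψ / 2) := by
    rw [← Real.sin_two_mul]; congr 1; ring
  have hsc := Real.sin_sq_add_cos_sq (ψ / 2)
  have hangle : χ ≤ Real.pi / 2 + ψ / 2 := by
    by_contra! hlt
    have hneg : Real.cos (χ - ψ / 2) < 0 :=
      Real.cos_neg_of_pi_div_two_lt_of_lt (by linarith) (by linarith)
    -- Both sides are the real part of `(v - 1) * exp (-iψ/2)`.
    have : σ * Real.cos (χ - ψ / 2) = (ρ - 1) * Real.cos (ψ / 2) := by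
      rw [Real.cos_sub, mul_add, ← mul_assoc, ← mul_assoc, hre, him', hsin, hcos]
      linear_combination (2 * ρ * Real.cos (ψ / 2)) * hsc
    have h1 : σ * Real.cos (χ - ψ / 2) < 0 := mul_neg_of_pos_of_neg hσ0 hneg
    have h2 : 0 ≤ (ρ - 1) * Real.cos (ψ / 2) := mul_nonneg (by linarith) hc2
    linarith
  have hs2 : 0 ≤ Real.sin (ψ / 2) := Real.sin_nonneg_of_nonneg_of_le_pi (by linarith) (by linarith)
  have hsinle : Real.sin (ψ / 2) ≤ r / 2 := by
    have hσsq : σ ^ 2 = ρ ^ 2 - 2 * ρ * Real.cos ψ + 1 := by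
      have e1 := Real.sin_sq_add_cos_sq χ
      have e2 := Real.sin_sq_add_cos_sq ψ
      calc σ ^ 2 = (σ * Real.cos χ) ^ 2 + (σ * Real.sin χ) ^ 2 := by
            linear_combination (-σ ^ 2) * e1
        _ = _ := by rw [hre, him']; linear_combination (ρ ^ 2) * e2
    have : (2 * Real.sin (ψ / 2)) ^ 2 ≤ σ ^ 2 := by
      -- This product is `σ ^ 2 - (2 - 2 cos ψ)`: the distance to `1` along the ray of `v` is
      -- smallest, for `1 ≤ ρ`, on the unit circle.
      have e3 : 0 ≤ (ρ - 1) * (ρ + 1 - 2 * Real.cos ψ) :=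
        mul_nonneg (by linarith) (by linarith [Real.cos_le_one ψ])
      rw [hσsq]
      rw [hcos] at e3 ⊢
      nlinarith
    have := abs_le_of_sq_le_sq' this hσ0.le
    linarith [this.2]
  have hψφ : ψ / 2 ≤ Real.pi / 2 - Real.arccos (r / 2) := by
    rw [← Real.arcsin_eq_pi_div_two_sub_arccos,
      ← Real.arcsin_sin (x := ψ / 2) (by linarith) (by linarith)]
    exact Real.monotone_arcsin hsinle
  set w := Real.pi - χ - m * ψ with hw
  have hwlow : (2 * m + 1) * Real.arccos (r / 2) - m * Real.pi ≤ w := by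
    have hm : (0 : ℝ) ≤ 2 * m + 1 := by positivity
    have := mul_le_mul_of_nonneg_left hψφ hm
    linarith
  have hwup : w ≤ Real.pi := by
    have : 0 ≤ (m : ℝ) * ψ := by positivity
    linarith
  have hexp : exp (-(I * w)) = exp (-(I * u)) := by
    have hr' : (r : ℂ) ≠ 0 := by exact_mod_cast hr.ne'
    apply mul_left_cancel₀ hr'
    rw [← h, show (1 - v) = -(v - 1) by ring, ← hvp', ← hvp, ← hnorm,
      show -(I * (w : ℂ)) = m * (ψ * I) + (χ * I - Real.pi * I) by rw [hw]; push_cast; ring,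
      exp_add, exp_nat_mul, exp_sub, exp_pi_mul_I]
    push_cast
    ring
  obtain ⟨k, hk⟩ := exp_eq_exp_iff_exists_int.1 hexp
  have hk' : w = u - 2 * Real.pi * k := by
    have := congrArg im hk
    simp at this
    linarith
  obtain ⟨hu1, hu2⟩ := abs_lt.1 hu
  -- If `k ≤ -1` then `w ≥ u + 2π > π`; if `k ≥ 0` then `w ≤ u`, below the lower bound for `w`.
  have hk1 : (-1 : ℝ) < k := by
    by_contra! hlt
    nlinarith
  have hk2 : (k : ℝ) < 0 := by
    by_contra! hlt
    nlinarith
  have : (-1 : ℤ) < k := by exact_mod_cast hk1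
  have : k < (0 : ℤ) := by exact_mod_cast hk2
  omega

theorem conj_mul_exp {m : ℕ} {r u : ℝ} {v : ℂ}
    (h : v ^ m * (1 - v) = r * Complex.exp (-(Complex.I * u))) :
    (starRingEnd ℂ v) ^ m * (1 - starRingEnd ℂ v) =
      r * Complex.exp (-(Complex.I * (-u : ℝ))) := by
  have := congrArg (starRingEnd ℂ) h
  simpa [← Complex.exp_conj] using this

theorem not_abs_lt_of_one_le_norm {m : ℕ} {r u : ℝ} {v : ℂ} (hr : 0 < r) (hv : 1 ≤ ‖v‖)
    (h : v ^ m * (1 - v) = r * Complex.exp (-(Complex.I * u))) :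
    ¬ |u| < (2 * m + 1) * Real.arccos (r / 2) - m * Real.pi := by
  rcases le_total 0 v.im with him | him
  · exact not_abs_lt_of_im_nonneg hr hv him h
  · rw [← abs_neg]
    exact not_abs_lt_of_im_nonneg hr (by simpa using hv) (by simpa using him) (conj_mul_exp h)

/-! ### Construction of a solution outside the open disc -/

/-- The law of sines for the triangle with vertices `0`, `1`, `v`, where `v` has argument `x` and
`v - 1` has argument `y`. -/
theorem sin_mul_exp_sub_sin (x y : ℝ) :
    (Real.sin y : ℂ) * Complex.exp (x * Complex.I) - Real.sin (y - x) =
      Real.sin x * Complex.exp (y * Complex.I) := by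
  apply Complex.ext
  · simp [Complex.exp_ofReal_mul_I_re, Real.sin_sub, -Complex.ofReal_sub, -Complex.ofReal_sin]
    ring
  · simp [Complex.exp_ofReal_mul_I_im, -Complex.ofReal_sub, -Complex.ofReal_sin]
    ring

/-- Here `x = arg v`, `y = A - m x = arg (v - 1)` and `A = π - u`. By the law of sines the equation
prescribes the modulus `r`; the last inequality, `y ≤ π/2 + x/2`, encodes `1 ≤ ‖v‖`. -/
theorem exists_angle {m : ℕ} {r A : ℝ} (hm : 1 ≤ m) (hr : 0 < r) (hr2 : r ≤ 2) (hA0 : 0 < A)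
    (hAπ : A ≤ Real.pi)
    (hA : A ≤ Real.pi - ((2 * m + 1) * Real.arccos (r / 2) - m * Real.pi)) :
    ∃ x : ℝ, 0 ≤ x ∧ (m + 1) * x < A ∧ A ≤ Real.pi / 2 + (m + 1 / 2) * x ∧
      Real.sin (A - m * x) ^ m * Real.sin x = r * Real.sin (A - (m + 1) * x) ^ (m + 1) := by
  have hpi := Real.pi_pos
  have hm1 : (1 : ℝ) ≤ m := by exact_mod_cast hm
  -- At `x₁` the point `v` is on the unit circle and `‖v - 1‖ = 2 sin (x₁/2)`, at most `r` by `hA`;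
  -- at `A / (m + 1)` the sides become parallel and `v` escapes to infinity.
  set x₁ := (A - Real.pi / 2) / (m + 1 / 2) with hx₁
  have hx₁' : (m + 1 / 2) * x₁ = A - Real.pi / 2 := by
    rw [hx₁]; field_simp
  have hlt : max 0 x₁ < A / (m + 1) := by
    apply max_lt (by positivity)
    rw [hx₁, div_lt_div_iff₀ (by positivity) (by positivity)]
    nlinarith
  let F : ℝ → ℝ := fun x =>
    Real.sin (A - m * x) ^ m * Real.sin x - r * Real.sin (A - (m + 1) * x) ^ (m + 1)
  have hF : Continuous F := by fun_prop
  have hFend : 0 < F (A / (m + 1)) := by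
    have e1 : A - m * (A / (m + 1)) = A / (m + 1) := by field_simp; ring
    have e2 : A - (m + 1) * (A / (m + 1)) = 0 := by field_simp; ring
    have hs : 0 < Real.sin (A / (m + 1)) := by
      apply Real.sin_pos_of_pos_of_lt_pi (by positivity)
      rw [div_lt_iff₀ (by positivity)]
      nlinarith
    simp only [F, e1, e2, Real.sin_zero]
    rw [zero_pow (by omega)]
    simp only [mul_zero, sub_zero]
    positivity
  have hFstart : F (max 0 x₁) ≤ 0 := by
    rcases le_total x₁ 0 with h | h
    · rw [max_eq_left h]
      have : 0 ≤ Real.sin A := Real.sin_nonneg_of_nonneg_of_le_pi hA0.le hAπ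
      simp only [F, Real.sin_zero, mul_zero, sub_zero, zero_sub]
      have : 0 ≤ r * Real.sin A ^ (m + 1) := by positivity
      linarith
    · rw [max_eq_right h]
      have e1 : A - m * x₁ = Real.pi / 2 + x₁ / 2 := by linarith
      have e2 : A - (m + 1) * x₁ = Real.pi / 2 - x₁ / 2 := by linarith
      have hx2 : x₁ / 2 ≤ Real.pi / 2 - Real.arccos (r / 2) := by
        have : (2 * m + 1) * (x₁ / 2) ≤ (2 * m + 1) * (Real.pi / 2 - Real.arccos (r / 2)) := by
          linarith
        exact le_of_mul_le_mul_left this (by positivity)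
      rw [← Real.arcsin_eq_pi_div_two_sub_arccos] at hx2
      have hle := Real.arcsin_le_pi_div_two (r / 2)
      have hs : Real.sin (x₁ / 2) ≤ r / 2 := by
        rw [← Real.sin_arcsin (x := r / 2) (by linarith) (by linarith)]
        exact Real.sin_le_sin_of_le_of_le_pi_div_two (by linarith) hle hx2
      have hc : 0 ≤ Real.cos (x₁ / 2) :=
        Real.cos_nonneg_of_mem_Icc ⟨by linarith, by linarith⟩
      have e3 : Real.sin x₁ = 2 * Real.sin (x₁ / 2) * Real.cos (x₁ / 2) := by
        rw [← Real.sin_two_mul]; congr 1; ring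
      simp only [F, e1, e2, e3]
      rw [Real.sin_pi_div_two_sub, add_comm (Real.pi / 2), Real.sin_add_pi_div_two]
      have : 0 ≤ Real.cos (x₁ / 2) ^ (m + 1) * (r - 2 * Real.sin (x₁ / 2)) :=
        mul_nonneg (by positivity) (by linarith)
      rw [pow_succ] at this ⊢
      nlinarith
  obtain ⟨x, hx, hx0⟩ := intermediate_value_Icc hlt.le hF.continuousOn ⟨hFstart, hFend.le⟩
  have hxne : x < A / (m + 1) := by
    apply lt_of_le_of_ne hx.2
    rintro rfl
    exact hFend.ne' hx0
  refine ⟨x, (le_max_left _ _).trans hx.1, ?_, ?_, sub_eq_zero.1 hx0⟩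
  · rw [lt_div_iff₀ (by positivity)] at hxne
    linarith
  · have := mul_le_mul_of_nonneg_left ((le_max_right _ _).trans hx.1)
      (show (0 : ℝ) ≤ m + 1 / 2 by positivity)
    linarith

/-- Covers `u = π`, where the triangle degenerates to the real axis. -/
theorem exists_real_pow_mul_sub {m : ℕ} {r : ℝ} (hr : 0 < r) (hr2 : r ≤ 1) :
    ∃ x : ℝ, 1 ≤ x ∧ x ^ m * (x - 1) = r := by
  have hF : Continuous fun x : ℝ => x ^ m * (x - 1) := by fun_prop
  have h2 : (1 : ℝ) ≤ 2 ^ m := one_le_pow₀ (by norm_num)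
  obtain ⟨x, hx, hx0⟩ := intermediate_value_Icc (show (1 : ℝ) ≤ 2 by norm_num) hF.continuousOn
    (show r ∈ Set.Icc _ _ from ⟨by simpa using hr.le, by norm_num; linarith⟩)
  exact ⟨x, hx.1, hx0⟩

open Complex in
theorem exists_one_le_norm_of_nonneg {m : ℕ} {r u : ℝ} (hm : 1 ≤ m) (hr : 0 < r) (hr1 : r ≤ 1)
    (hu0 : 0 ≤ u) (huπ : u ≤ Real.pi)
    (hu : (2 * m + 1) * Real.arccos (r / 2) - m * Real.pi ≤ u) :
    ∃ v : ℂ, 1 ≤ ‖v‖ ∧ v ^ m * (1 - v) = r * exp (-(I * u)) := by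
  have hpi := Real.pi_pos
  rcases huπ.eq_or_lt with rfl | huπ
  · obtain ⟨x, hx1, hx⟩ := exists_real_pow_mul_sub (m := m) hr hr1
    refine ⟨x, ?_, ?_⟩
    · rw [norm_real, Real.norm_of_nonneg (by linarith)]; exact hx1
    · rw [mul_comm I, exp_neg, exp_pi_mul_I, ← hx]
      push_cast
      ring
  obtain ⟨x, hx0, hxA, hxl, hx⟩ := exists_angle (A := Real.pi - u) hm hr (by linarith)
    (by linarith) (by linarith) (by linarith)
  set y := Real.pi - u - m * x with hy
  have hm1 : (1 : ℝ) ≤ m := by exact_mod_cast hm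
  have hmx : 0 ≤ m * x := by positivity
  have hyx : Real.pi - u - (m + 1) * x = y - x := by rw [hy]; ring
  rw [hyx] at hx
  have hs : 0 < Real.sin (y - x) := Real.sin_pos_of_pos_of_lt_pi (by linarith) (by linarith)
  have hle : Real.sin (y - x) ≤ Real.sin y := by
    have h1 : 0 ≤ Real.sin (x / 2) :=
      Real.sin_nonneg_of_nonneg_of_le_pi (by linarith) (by nlinarith)
    have h2 : 0 ≤ Real.cos (y - x / 2) :=
      Real.cos_nonneg_of_mem_Icc ⟨by linarith, by linarith⟩
    have h3 : Real.sin y - Real.sin (y - x) = 2 * Real.sin (x / 2) * Real.cos (y - x / 2) := by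
      rw [Real.sin_sub_sin]; congr 2 <;> ring_nf
    have := mul_nonneg h1 h2
    linarith
  have hsC : (Real.sin (y - x) : ℂ) ≠ 0 := by exact_mod_cast hs.ne'
  have htri := sin_mul_exp_sub_sin x y
  refine ⟨(Real.sin y / Real.sin (y - x) : ℝ) * exp (x * I), ?_, ?_⟩
  · rw [norm_mul, norm_exp_ofReal_mul_I, mul_one, norm_real,
      Real.norm_of_nonneg (div_nonneg (hs.le.trans hle) hs.le), le_div_iff₀ hs]
    linarith
  · have h1 : 1 - ((Real.sin y / Real.sin (y - x) : ℝ) : ℂ) * exp (x * I) =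
        -(Real.sin x * exp (y * I)) / Real.sin (y - x) := by
      rw [← htri, ofReal_div]; field_simp; ring
    have h2 : exp (-(I * u)) = exp (x * I) ^ m * -exp (y * I) := by
      rw [← exp_nat_mul, show -(I * (u : ℂ)) = m * (x * I) + (y * I - Real.pi * I) by
        rw [hy]; push_cast; ring, exp_add, exp_sub, exp_pi_mul_I]
      ring
    have hxC : (Real.sin y : ℂ) ^ m * Real.sin x = r * (Real.sin (y - x) : ℂ) ^ (m + 1) := by
      exact_mod_cast hx
    rw [h1, h2, ofReal_div, mul_pow, div_pow]
    generalize (Real.sin (y - x) : ℂ) = S at *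
    field_simp
    linear_combination -hxC

theorem exists_one_le_norm {m : ℕ} {r u : ℝ} (hm : 1 ≤ m) (hr : 0 < r) (hr1 : r ≤ 1)
    (huπ : |u| ≤ Real.pi) (hu : (2 * m + 1) * Real.arccos (r / 2) - m * Real.pi ≤ |u|) :
    ∃ v : ℂ, 1 ≤ ‖v‖ ∧ v ^ m * (1 - v) = r * Complex.exp (-(Complex.I * u)) := by
  obtain ⟨v, hv, h⟩ := exists_one_le_norm_of_nonneg hm hr hr1 (abs_nonneg u) huπ hu
  rcases abs_choice u with hu | hu <;> rw [hu] at h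
  · exact ⟨v, hv, h⟩
  · exact ⟨starRingEnd ℂ v, by simpa using hv, by simpa using conj_mul_exp h⟩

/-! ### Normal form and conclusion -/

theorem projPoint_inj {b c b' c' : ℂ} : projPoint b c = projPoint b' c' ↔ b = b' ∧ c = c' := by
  constructor
  · intro h
    obtain ⟨a, ha⟩ := (Projectivization.mk_eq_mk_iff' ℂ _ _ _ _).1 h
    have h0 := congrFun ha 0
    have h1 := congrFun ha 1
    have h2 := congrFun ha 2
    simp at h0 h1 h2
    subst h0
    simp at h1 h2
    exact ⟨h1.symm, h2.symm⟩
  · rintro ⟨rfl, rfl⟩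
    rfl

theorem projPoint_mem_stabilityRegion {n m : ℕ} {b c : ℂ} :
    projPoint b c ∈ stabilityRegion n m ↔ IsSchurStable (complexTrinomial n m 1 b c) := by
  constructor
  · rintro ⟨b', c', h, hs⟩
    obtain ⟨rfl, rfl⟩ := projPoint_inj.1 h
    exact hs
  · intro h
    exact ⟨b, c, rfl, h⟩

open Complex in
/-- The substitution `ζ = -exp (i (t - s)) v` puts the trinomial in normal form. -/
theorem isRoot_complexTrinomial_iff (m : ℕ) (r s t : ℝ) (v : ℂ) :
    (complexTrinomial (m + 1) m 1 (exp (I * t) * exp (-(I * s)))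
      ((-1) ^ (m + 1) * r * exp (-(I * (m + 1 : ℕ) * s)))).IsRoot
        (-(exp (I * t) * exp (-(I * s)) * v)) ↔
      v ^ m * (1 - v) = r * exp (-(I * ((m + 1) * t : ℝ))) := by
  have e1 : exp (-(I * (m + 1 : ℕ) * s)) = exp (-(I * s)) ^ (m + 1) := by
    rw [← exp_nat_mul]; congr 1; ring
  have e2 : exp (-(I * ((m + 1) * t : ℝ))) = (exp (I * t) ^ (m + 1))⁻¹ := by
    rw [← exp_nat_mul, ← exp_neg]; congr 1; push_cast; ring
  have hS : exp (-(I * s)) ≠ 0 := exp_ne_zero _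
  have hT : exp (I * t) ≠ 0 := exp_ne_zero _
  rw [e1, e2]
  generalize exp (-(I * s)) = S at *
  generalize exp (I * t) = T at *
  simp only [complexTrinomial, Polynomial.IsRoot.def, Polynomial.eval_add, Polynomial.eval_mul,
    Polynomial.eval_C, Polynomial.eval_pow, Polynomial.eval_X]
  have key : 1 * (-(T * S * v)) ^ (m + 1) + T * S * (-(T * S * v)) ^ m +
      (-1) ^ (m + 1) * r * S ^ (m + 1) =
      (-1) ^ m * S ^ (m + 1) * T ^ (m + 1) * (v ^ m * (1 - v) - r * (T ^ (m + 1))⁻¹) := by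
    rw [neg_pow (T * S * v), neg_pow (T * S * v) m, mul_pow, mul_pow, mul_pow, mul_pow, mul_sub,
      show (-1) ^ m * S ^ (m + 1) * T ^ (m + 1) * (r * (T ^ (m + 1))⁻¹) =
        (-1) ^ m * S ^ (m + 1) * r by field_simp]
    ring
  rw [key, mul_eq_zero, sub_eq_zero]
  have : (-1 : ℂ) ^ m * S ^ (m + 1) * T ^ (m + 1) ≠ 0 := by simp [hS, hT]
  simp [hS, hT]

open Complex in
theorem exists_normal_form (m : ℕ) {b c : ℂ} (hb : ‖b‖ = 1) (hc : 0 < ‖c‖) :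
    ∃ s ∈ Set.Icc (0 : ℝ) (2 * Real.pi), ∃ t : ℝ, (m + 1) * |t| ≤ Real.pi ∧
      b = exp (I * t) * exp (-(I * s)) ∧
      c = (-1) ^ (m + 1) * ‖c‖ * exp (-(I * (m + 1 : ℕ) * s)) := by
  have hc0 : c ≠ 0 := norm_pos_iff.1 hc
  have hcC : (‖c‖ : ℂ) ≠ 0 := by exact_mod_cast hc.ne'
  -- The normal form forces `exp (i(m+1)t) = q`; the principal argument yields `(m + 1) * |t| ≤ π`.
  set q : ℂ := (-1) ^ (m + 1) * ‖c‖ * b ^ (m + 1) / c with hq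
  have hqn : ‖q‖ = 1 := by simp [hq, hb, hc0]
  have hqe : exp (arg q * I) = q := by
    have := norm_mul_exp_arg_mul_I q
    rwa [hqn, ofReal_one, one_mul] at this
  set t : ℝ := arg q / (m + 1) with ht
  have htm : (m + 1) * t = arg q := by rw [ht]; field_simp
  set d : ℂ := b * exp (-(I * t)) with hd
  have hdn : ‖d‖ = 1 := by
    rw [hd, norm_mul, hb, show -(I * (t : ℂ)) = ((-t : ℝ) : ℂ) * I by push_cast; ring,
      norm_exp_ofReal_mul_I, mul_one]
  have hde : exp (arg d * I) = d := by
    have := norm_mul_exp_arg_mul_I d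
    rwa [hdn, ofReal_one, one_mul] at this
  set s := toIcoMod Real.two_pi_pos 0 (-arg d) with hs
  have hsd : exp (-(I * s)) = d := by
    rw [← hde, exp_eq_exp_iff_exists_int]
    refine ⟨toIcoDiv Real.two_pi_pos 0 (-arg d), ?_⟩
    have : s = -arg d - toIcoDiv Real.two_pi_pos 0 (-arg d) • (2 * Real.pi) := rfl
    rw [this, zsmul_eq_mul]
    push_cast
    ring
  have hsI := toIcoMod_mem_Ico Real.two_pi_pos 0 (-arg d)
  rw [zero_add] at hsI
  refine ⟨s, Set.Ico_subset_Icc_self hsI, t, ?_, ?_, ?_⟩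
  · have hm : (0 : ℝ) ≤ m + 1 := by positivity
    rw [← abs_of_nonneg hm, ← abs_mul, htm]
    exact abs_arg_le_pi q
  · rw [hsd, hd, mul_left_comm, ← exp_add, add_neg_cancel, exp_zero, mul_one]
  · have e1 : exp (-(I * (m + 1 : ℕ) * s)) = d ^ (m + 1) := by
      rw [← hsd, ← exp_nat_mul]; congr 1; ring
    have e2 : exp (-(I * t)) ^ (m + 1) = q⁻¹ := by
      rw [← hqe, ← exp_nat_mul, ← exp_neg, ← htm]; congr 1; push_cast; ring
    have hb0 : b ≠ 0 := by rw [← norm_pos_iff, hb]; exact one_pos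
    rw [e1, hd, mul_pow, e2, hq]
    field_simp

theorem isSchurStable_iff_abs_lt {m : ℕ} {r s t : ℝ} (hm : 1 ≤ m) (hr : 0 < r) (hr1 : r ≤ 1)
    (ht : (m + 1) * |t| ≤ Real.pi) :
    IsSchurStable (complexTrinomial (m + 1) m 1
      (Complex.exp (Complex.I * t) * Complex.exp (-(Complex.I * s)))
      ((-1) ^ (m + 1) * r * Complex.exp (-(Complex.I * (m + 1 : ℕ) * s)))) ↔
      (m + 1) * |t| < (2 * m + 1) * Real.arccos (r / 2) - m * Real.pi := by
  have habs : (m + 1) * |t| = |(m + 1) * t| := by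
    rw [abs_mul, abs_of_nonneg (show (0 : ℝ) ≤ m + 1 by positivity)]
  set d := Complex.exp (Complex.I * t) * Complex.exp (-(Complex.I * s)) with hd
  have hd0 : d ≠ 0 := mul_ne_zero (Complex.exp_ne_zero _) (Complex.exp_ne_zero _)
  have hdn : ‖d‖ = 1 := by
    rw [hd, ← Complex.exp_add, show Complex.I * (t : ℂ) + -(Complex.I * s) =
      ((t - s : ℝ) : ℂ) * Complex.I by push_cast; ring, Complex.norm_exp_ofReal_mul_I]
  rw [habs] at ht ⊢
  constructor
  · intro h
    by_contra! hle
    obtain ⟨v, hv, hroot⟩ := exists_one_le_norm hm hr hr1 ht hle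
    have := h _ ((isRoot_complexTrinomial_iff m r s t v).2 hroot)
    rw [← hd, norm_neg, norm_mul, hdn, one_mul] at this
    linarith
  · intro hlt z hz
    by_contra! hz1
    have hzv : z = -(d * (-z / d)) := by field_simp
    rw [hzv, hd, isRoot_complexTrinomial_iff, ← hd] at hz
    exact not_abs_lt_of_one_le_norm hr (by simpa [hdn] using hz1) hz hlt

theorem corollary1p12 (n m : ℕ) (hn : 2 ≤ n) (hm : m = n - 1) (b c : ℂ)
    (hb : ‖b‖ = 1) (hc0 : 0 < ‖c‖) (hc1 : ‖c‖ < 1) :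
    projPoint b c ∈ stabilityRegion n m ↔
      ((((n : ℝ) - 1) / (2 * (n : ℝ) - 1)) * Real.pi < Real.arccos (‖c‖ / 2) ∧
        Real.arccos (‖c‖ / 2) < Real.pi / 2) ∧
      ∃ s ∈ Set.Icc (0 : ℝ) (2 * Real.pi), ∃ t : ℝ,
        |t| < ((2 * (n : ℝ) - 1) * Real.arccos (‖c‖ / 2) - ((n : ℝ) - 1) * Real.pi) / (n : ℝ) ∧
        projPoint b c =
          projPoint (Complex.exp (Complex.I * (t : ℂ)) * Complex.exp (-(Complex.I * (s : ℂ))))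
            ((-1 : ℂ) ^ n * (‖c‖ : ℂ) * Complex.exp (-(Complex.I * (n : ℂ) * (s : ℂ)))) := by
  obtain rfl : n = m + 1 := by omega
  have hm1 : 1 ≤ m := by omega
  have hmpos : (0 : ℝ) < m + 1 := by positivity
  have hacos : Real.arccos (‖c‖ / 2) < Real.pi / 2 :=
    Real.arccos_lt_pi_div_two.2 (by positivity)
  have ebound : (2 * ((m + 1 : ℕ) : ℝ) - 1) * Real.arccos (‖c‖ / 2) -
      (((m + 1 : ℕ) : ℝ) - 1) * Real.pi =
      (2 * m + 1) * Real.arccos (‖c‖ / 2) - m * Real.pi := by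
    push_cast; ring
  rw [projPoint_mem_stabilityRegion, ebound]
  constructor
  · intro h
    obtain ⟨s, hs, t, ht, hbe, hce⟩ := exists_normal_form m hb hc0
    have hlt := h
    rw [hbe, hce, isSchurStable_iff_abs_lt hm1 hc0 hc1.le ht] at hlt
    refine ⟨⟨?_, hacos⟩, s, hs, t, ?_, projPoint_inj.2 ⟨hbe, hce⟩⟩
    · have : 0 ≤ (m + 1) * |t| := by positivity
      rw [show (2 * ((m + 1 : ℕ) : ℝ) - 1) = 2 * m + 1 by push_cast; ring,
        show (((m + 1 : ℕ) : ℝ) - 1) = m by push_cast; ring, div_mul_eq_mul_div,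
        div_lt_iff₀ (by positivity)]
      linarith
    · rw [Nat.cast_add_one, lt_div_iff₀ hmpos]
      linarith
  · rintro ⟨-, s, -, t, ht, heq⟩
    obtain ⟨hbe, hce⟩ := projPoint_inj.1 heq
    rw [Nat.cast_add_one, lt_div_iff₀ hmpos, mul_comm] at ht
    -- Since `arccos (‖c‖/2) < π/2`, any `t` allowed in (ii) meets the normalization `(m + 1) * |t|
    -- ≤ π`.
    have hle : (2 * m + 1) * Real.arccos (‖c‖ / 2) - m * Real.pi ≤ Real.pi := by
      have := mul_le_mul_of_nonneg_left hacos.le (show (0 : ℝ) ≤ 2 * m + 1 by positivity)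
      linarith [Real.pi_pos]
    rw [hbe, hce]
    exact (isSchurStable_iff_abs_lt hm1 hc0 hc1.le (ht.le.trans hle)).2 ht
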